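/- Let $2^\omega$ be the Cantor space, with the product topology, coordinatewise addition modulo $2$ denoted $\oplus$, and Lebesgue measure (the countable power of the fair coin measure on $\{0,1\}$). Let $\mathrm{cov}(\mathcal N)$ be the least cardinality of a family of Lebesgue-null subsets of $2^\omega$ that covers $2^\omega$, let $\mathfrak b$ be the least cardinality of a subset of $\omega^\omega$ that is unbounded with respect to eventual domination $\le^*$, and let $\mathfrak c=2^{\aleph_0}$. A perfect set is a homeomorphic copy of $2^\omega$. For a subset $X$ of a topological space $S$: - $X$ is Hurewicz if for every sequence $\mathcal U_0,\mathcal U_1,\dots$ of open covers of $X$ there are finite sets $\mathcal F_n\subseteq\mathcal U_n$ such that for every $x\in X$ we have $x\in\bigcup\mathcal F_n$ for all but finitely many $n$; - $X$ is a $\lambda'$-set if every countable $A\subseteq S$ is a $G_\delta$-set in the relative topology of $X\cup A$; - $X$ is totally imperfect if it contains no perfect set; - for $S=2^\omega$, $X$ is perfectly meager in the transitive sense (PMT) if for every perfect set $P\subseteq 2^\omega$ there is a $\sigma$-compact set $F\subseteq 2^\omega$ containing $X$ such that $F\cap(t\oplus P)$ is meager in the relative topology of $t\oplus P$ for all $t\in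 2^\omega$. Theorem 2.1. Assume that $\mathrm{cov}(\mathcal N)=\mathfrak b=\mathfrak c$. Then there is a set $X\subseteq 2^\omega\times 2^\omega$ such that 1. $X$ is Hurewicz; 2. $X$ is a $\lambda'$-set (in $2^\omega\times 2^\omega$); 3. $X$ is totally imperfect; 4. $\pi[X]=2^\omega$, where $\pi$ is the projection onto the first coordinate; 5. there is a set $Y\subseteq 2^\omega$ homeomorphic to $X$ that is not PMT. The set $Y$ is Hurewicz and totally imperfect; thus, under this hypothesis, the question of Nowik and Tsaban whether every Hurewicz totally imperfect subset of $2^\omega$ is PMT has a negative answer. -/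

import Mathlib

open Set Filter Topology MeasureTheory

/-- The Cantor space `2^ω`, with its product topology and product (Borel) `σ`-algebra. -/
abbrev CantorSpace : Type := ℕ → Bool

/-- The Lebesgue measure on `2^ω`: the countable power of the fair coin measure on `{0, 1}`. -/
noncomputable def cantorMeasure : Measure CantorSpace :=
  Measure.infinitePi (fun _ : ℕ => (PMF.uniformOfFintype Bool).toMeasure)

/-- `cov(N)`: the least cardinality of a family of Lebesgue-null subsets of `2^ω` covering `2^ω`.
(A measure is evaluated on arbitrary sets as an outer measure, so the null sets here
need not be Borel.) -/
noncomputable def covNull : Cardinal.{0} :=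
  sInf {κ | ∃ 𝒜 : Set (Set CantorSpace),
    (∀ A ∈ 𝒜, cantorMeasure A = 0) ∧ ⋃₀ 𝒜 = univ ∧ Cardinal.mk 𝒜 = κ}

/-- `𝔟`: the least cardinality of a subset of `ω^ω` that is unbounded with respect to
eventual domination. -/
noncomputable def boundingNumber : Cardinal.{0} :=
  sInf {κ | ∃ B : Set (ℕ → ℕ),
    (¬ ∃ g : ℕ → ℕ, ∀ f ∈ B, ∀ᶠ n in atTop, f n ≤ g n) ∧ Cardinal.mk B = κ}

/-- `P` is a perfect set: a homeomorphic copy of `2^ω`. -/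
def IsPerfectSet {α : Type*} [TopologicalSpace α] (P : Set α) : Prop :=
  Nonempty (CantorSpace ≃ₜ P)

/-- `X` contains no perfect set. -/
def IsTotallyImperfect {α : Type*} [TopologicalSpace α] (X : Set α) : Prop :=
  ¬ ∃ P : Set α, P ⊆ X ∧ IsPerfectSet P

/-- The Hurewicz covering property: for every sequence of open covers `𝒰 n` of `X` there are
finite subfamilies `ℱ n` of `𝒰 n` such that every point of `X` lies in `⋃₀ ℱ n` for all but
finitely many `n`. -/
def IsHurewicz {α : Type*} [TopologicalSpace α] (X : Set α) : Prop :=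
  ∀ 𝒰 : ℕ → Set (Set α),
    (∀ n, (∀ U ∈ 𝒰 n, IsOpen U) ∧ X ⊆ ⋃₀ 𝒰 n) →
    ∃ ℱ : ℕ → Set (Set α),
      (∀ n, ℱ n ⊆ 𝒰 n ∧ (ℱ n).Finite) ∧
      ∀ x ∈ X, ∀ᶠ n in atTop, x ∈ ⋃₀ ℱ n

/-- `X` is a `λ'`-set: every countable subset `A` of the ambient space is a `G_δ`-set in the
relative topology of `X ∪ A`. -/
def IsLambdaPrime {α : Type*} [TopologicalSpace α] (X : Set α) : Prop :=
  ∀ A : Set α, A.Countable → IsGδ ((↑) ⁻¹' A : Set ↥(X ∪ A))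

/-- The group operation of `2^ω`: coordinatewise addition modulo `2`. -/
def cantorAdd (x y : CantorSpace) : CantorSpace := fun n => xor (x n) (y n)

/-- The translate `t ⊕ A`. -/
def cantorTranslate (t : CantorSpace) (A : Set CantorSpace) : Set CantorSpace :=
  cantorAdd t '' A

/-- `X` is perfectly meager in the transitive sense: for every perfect set `P` there is a
`σ`-compact set `F ⊇ X` such that `F ∩ (t ⊕ P)` is meager in the relative topology of `t ⊕ P`
for all `t`. -/
def IsPMT (X : Set CantorSpace) : Prop :=
  ∀ P : Set CantorSpace, IsPerfectSet P →
    ∃ F : Set CantorSpace, IsSigmaCompact F ∧ X ⊆ F ∧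
      ∀ t : CantorSpace, IsMeagre ((↑) ⁻¹' F : Set ↥(cantorTranslate t P))

/-! ### Cardinal invariants and null sets. -/

section Cardinal

/-! Work with pairs (x, y), where y is read as a sequence of blocks, block `k` having length `k +
2`. A parameter is a point x with a binary tree T of block sequences; it gives a random point, a
random branch of T in the fibre over x. Since cov(N) = 𝔠, some X meets every Borel set of positive
probability for some parameter, yet has fewer than 𝔠 points in each Borel set that is null for all
parameters (`exists_isGenericSet`).

The parameter space is compact, so open exhaustions that are almost sure for each parameter are so
uniformly (Dini). By Borel–Cantelli, finite choices from covers of X then succeed off a set null for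
all parameters, and 𝔟 = 𝔠 handles the fewer than 𝔠 points left: X is Hurewicz. The same pattern
gives λ', hence total imperfectness. X meets every fibre because x is a parameter.

PMT fails for the perfect set P of blockwise constant sequences over zero. Let compact sets `K n`
cover the copy of X. If trees escaping `K n` existed above every node, for every n, Baire category
would give one tree missing all `K n`, although X has a point on it. So some `K n` has a node
without an escaping tree. Two escaping successors would join into an escaping tree, so counting
2^(k+2) labels against 2^(k+1) flips (`exists_update_not_escapes`) builds y whose flips beyond that
node all lie in `K n`. Hence `K n` contains a relatively open piece of a translate of P. -/

theorem exists_eventual_bound {ι : Type} (f : ι → ℕ → ℕ)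
    (hι : Cardinal.mk ι < boundingNumber) :
    ∃ g : ℕ → ℕ, ∀ i, ∀ᶠ n in atTop, f i n ≤ g n := by
  by_contra h
  refine absurd (csInf_le' ⟨range f, ?_, rfl⟩ : boundingNumber ≤ Cardinal.mk (range f))
    (not_le.2 (Cardinal.mk_range_le.trans_lt hι))
  rintro ⟨g, hg⟩
  exact h ⟨g, fun i => hg _ ⟨i, rfl⟩⟩

theorem exists_notMem_of_null {ι : Type} (N : ι → Set CantorSpace)
    (hN : ∀ i, cantorMeasure (N i) = 0) (hι : Cardinal.mk ι < covNull) :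
    ∃ ω, ∀ i, ω ∉ N i := by
  by_contra! h
  refine absurd (csInf_le' ⟨range N, ?_, ?_, rfl⟩ : covNull ≤ Cardinal.mk (range N))
    (not_le.2 (Cardinal.mk_range_le.trans_lt hι))
  · rintro _ ⟨i, rfl⟩
    exact hN i
  · refine eq_univ_of_forall fun ω => ?_
    obtain ⟨i, hi⟩ := h ω
    exact ⟨N i, ⟨i, rfl⟩, hi⟩

instance : IsProbabilityMeasure cantorMeasure := by
  unfold cantorMeasure; infer_instance

/-- Splitting a point of the Cantor space into countably many columns. -/
def columns : CantorSpace ≃ᵐ (ℕ → CantorSpace) :=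
  (MeasurableEquiv.piCongrLeft (fun _ : ℕ × ℕ => Bool) Nat.pairEquiv.symm).trans
    (MeasurableEquiv.curry ℕ ℕ Bool)

theorem map_columns :
    cantorMeasure.map columns = Measure.infinitePi fun _ : ℕ => cantorMeasure := by
  have h1 := Measure.infinitePi_map_piCongrLeft
    (fun _ : ℕ × ℕ => (PMF.uniformOfFintype Bool).toMeasure) Nat.pairEquiv.symm
  have h2 := Measure.infinitePi_map_curry
    (fun _ _ : ℕ => (PMF.uniformOfFintype Bool).toMeasure)
  rw [← h1, Measure.map_map (MeasurableEquiv.measurable _) (MeasurableEquiv.measurable _)] at h2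
  exact h2

theorem measurePreserving_column (n : ℕ) :
    MeasurePreserving (fun ω => columns ω n) cantorMeasure cantorMeasure := by
  have h : MeasurePreserving columns cantorMeasure
      (Measure.infinitePi fun _ : ℕ => cantorMeasure) := ⟨columns.measurable, map_columns⟩
  exact (measurePreserving_eval_infinitePi (fun _ : ℕ => cantorMeasure) n).comp h

theorem measure_forall_column_notMem {C : Set CantorSpace} (hC : MeasurableSet C)
    (hpos : cantorMeasure C ≠ 0) : cantorMeasure {ω | ∀ n, columns ω n ∉ C} = 0 := by
  have key : ∀ n : ℕ, cantorMeasure {ω | ∀ n, columns ω n ∉ C} ≤ (cantorMeasure Cᶜ) ^ n := by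
    intro n
    have h := Measure.infinitePi_pi (fun _ : ℕ => cantorMeasure) (s := Finset.range n)
      (t := fun _ => Cᶜ) (fun _ _ => hC.compl)
    rw [← map_columns, columns.map_apply, Finset.prod_const, Finset.card_range] at h
    rw [← h]
    exact measure_mono fun ω hω i _ => hω i
  have hlt : cantorMeasure Cᶜ < 1 := by
    rw [prob_compl_eq_one_sub hC]
    exact ENNReal.sub_lt_self ENNReal.one_ne_top one_ne_zero hpos
  exact le_antisymm (ge_of_tendsto'
    (ENNReal.tendsto_pow_atTop_nhds_zero_of_lt_one hlt) key) zero_le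

/-- The columns of a random point are independent, so almost surely one of them lands in `C`. A
point avoiding this null exception and the pullbacks of all `N i` along all columns has a column as
required. -/
theorem exists_mem_notMem_of_null (hcov : covNull = Cardinal.continuum) {ι : Type}
    (N : ι → Set CantorSpace) (hN : ∀ i, cantorMeasure (N i) = 0)
    (hι : Cardinal.mk ι < Cardinal.continuum) {C : Set CantorSpace} (hC : MeasurableSet C)
    (hpos : cantorMeasure C ≠ 0) : ∃ ω ∈ C, ∀ i, ω ∉ N i := by
  obtain ⟨ω, hω⟩ := exists_notMem_of_null
    (fun o : Option (ι × ℕ) => o.elim {ω | ∀ n, columns ω n ∉ C}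
      fun p => (fun ω => columns ω p.2) ⁻¹' N p.1) (by
      rintro (_ | ⟨i, n⟩)
      · exact measure_forall_column_notMem hC hpos
      · exact (measurePreserving_column n).quasiMeasurePreserving.preimage_null (hN i)) (by
      rw [hcov, Cardinal.mk_option, Cardinal.mk_prod]
      refine Cardinal.add_lt_of_lt Cardinal.aleph0_le_continuum
        (Cardinal.mul_lt_of_lt Cardinal.aleph0_le_continuum (by simpa using hι) ?_) ?_
      · simpa using Cardinal.aleph0_lt_continuum
      · exact Cardinal.one_lt_aleph0.trans Cardinal.aleph0_lt_continuum)
  have h0 := hω none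
  simp only [Option.elim_none, mem_ofPred_eq, not_forall, not_not] at h0
  obtain ⟨n, hn⟩ := h0
  exact ⟨columns ω n, hn, fun i hi => hω (some (i, n)) hi⟩

theorem mk_measurableSet_le_continuum (E : Type) [MeasurableSpace E]
    [MeasurableSpace.CountablyGenerated E] :
    Cardinal.mk {B : Set E // MeasurableSet B} ≤ Cardinal.continuum := by
  have h := MeasurableSpace.cardinal_measurableSet_le_continuum
    (s := MeasurableSpace.countableGeneratingSet E)
    ((MeasurableSpace.countable_countableGeneratingSet.le_aleph0).trans
      Cardinal.aleph0_le_continuum)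
  rw [MeasurableSpace.generateFrom_countableGeneratingSet] at h
  exact h

end Cardinal

/-! ### Existence of generic sets. -/

section Generic

variable {Q E : Type} [MeasurableSpace E] {Φ : Q → CantorSpace → E}

/-- The set `X` is generic for the family `Φ` of parametrized random points: it meets each set that
has positive probability for some parameter, and it has fewer than continuum many points in each
set that is null for all parameters. -/
structure IsGenericSet (Φ : Q → CantorSpace → E) (X : Set E) : Prop where
  meets : ∀ q, ∀ C : Set E, MeasurableSet C → cantorMeasure (Φ q ⁻¹' C) ≠ 0 →
    ∃ ω, Φ q ω ∈ X ∩ C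
  small : ∀ B : Set E, MeasurableSet B → (∀ q, cantorMeasure (Φ q ⁻¹' B) = 0) →
    Cardinal.mk ↥(X ∩ B) < Cardinal.continuum

theorem exists_isGenericSet [MeasurableSpace.CountablyGenerated E]
    (hcov : covNull = Cardinal.continuum) (hQ : Cardinal.mk Q ≤ Cardinal.continuum)
    (hΦ : ∀ q, Measurable (Φ q)) : ∃ X : Set E, IsGenericSet Φ X := by
  classical
  rcases isEmpty_or_nonempty Q with hQe | ⟨⟨q₀⟩⟩
  · exact ⟨∅, fun q => hQe.elim q, fun B _ _ => by
      simp [Cardinal.continuum_pos]⟩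
  let κ := Cardinal.continuum.{0}.ord.ToType
  have hκ : Cardinal.mk κ = Cardinal.continuum := Cardinal.mk_ord_toType _
  let J := {p : Q × {B : Set E // MeasurableSet B} // cantorMeasure (Φ p.1 ⁻¹' p.2.1) ≠ 0}
  let ℬ := {B : {B : Set E // MeasurableSet B} // ∀ q, cantorMeasure (Φ q ⁻¹' B.1) = 0}
  have hJ : Cardinal.mk J ≤ Cardinal.mk κ := by
    refine (Cardinal.mk_subtype_le _).trans ?_
    rw [hκ, Cardinal.mk_prod, Cardinal.lift_id, Cardinal.lift_id]
    exact (mul_le_mul' hQ (mk_measurableSet_le_continuum E)).trans_eq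
      (Cardinal.mul_eq_self Cardinal.aleph0_le_continuum)
  have hB : Cardinal.mk ℬ ≤ Cardinal.mk κ := by
    rw [hκ]
    exact (Cardinal.mk_subtype_le _).trans (mk_measurableSet_le_continuum E)
  have : Nonempty J := ⟨⟨(q₀, ⟨univ, .univ⟩), by simp⟩⟩
  have : Nonempty ℬ := ⟨⟨⟨∅, .empty⟩, by simp⟩⟩
  obtain ⟨s⟩ := hJ
  obtain ⟨b⟩ := hB
  have hs := Function.invFun_surjective s.injective
  have hb := Function.invFun_surjective b.injective
  set S : κ → J := Function.invFun s
  set T : κ → ℬ := Function.invFun b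
  have hIio : ∀ α : κ, Cardinal.mk (Iio α) < Cardinal.continuum := fun α => by
    simpa [κ] using Cardinal.mk_Iio_lt α
  -- Task α avoids only the null sets listed before α. The choices do not depend on one another, so
  -- no recursion is needed.
  have hω : ∀ α : κ, ∃ ω ∈ Φ (S α).1.1 ⁻¹' (S α).1.2.1,
      ∀ β : Iio α, ω ∉ Φ (S α).1.1 ⁻¹' (T β).1.1 := fun α =>
    exists_mem_notMem_of_null hcov (fun β : Iio α => Φ (S α).1.1 ⁻¹' (T β).1.1)
      (fun β => (T β).2 _) (hIio α)
      ((hΦ _) (S α).1.2.2) (S α).2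
  choose ω hω hωN using hω
  refine ⟨range fun α => Φ (S α).1.1 (ω α), fun q C hC hq => ?_, fun B hB hBn => ?_⟩
  · obtain ⟨α, hα⟩ := hs ⟨(q, ⟨C, hC⟩), hq⟩
    have h1 := hω α
    have h2 : Φ (S α).1.1 (ω α) ∈ range fun α => Φ (S α).1.1 (ω α) := ⟨α, rfl⟩
    generalize ω α = w at h1 h2
    rw [hα] at h1 h2
    exact ⟨w, h2, h1⟩
  · obtain ⟨β, hβ⟩ := hb ⟨⟨B, hB⟩, hBn⟩
    have hsub : (range fun α => Φ (S α).1.1 (ω α)) ∩ B ⊆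
        (fun α => Φ (S α).1.1 (ω α)) '' (insert β (Iio β)) := by
      rintro _ ⟨⟨α, rfl⟩, hα⟩
      refine ⟨α, ?_, rfl⟩
      rcases lt_trichotomy α β with h | h | h
      · exact Or.inr h
      · exact Or.inl h
      · refine absurd ?_ (hωN α ⟨β, h⟩)
        simpa [hβ] using hα
    refine (Cardinal.mk_le_mk_of_subset hsub).trans_lt (Cardinal.mk_image_le.trans_lt ?_)
    exact Cardinal.mk_insert_le.trans_lt (Cardinal.add_lt_of_lt Cardinal.aleph0_le_continuum
      (hIio β) (Cardinal.one_lt_aleph0.trans Cardinal.aleph0_lt_continuum))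

end Generic

/-! ### Uniformity over a compact parameter space. -/

section Uniform

variable {Q E : Type} [TopologicalSpace Q] [TopologicalSpace E] {Φ : Q → CantorSpace → E}

/-- Inner regularity supplies a compact part of the preimage with measure above `r`; the tube lemma
keeps it inside the preimages for nearby parameters. -/
theorem isOpen_setOf_lt_measure_preimage (hΦ : Continuous fun p : Q × CantorSpace => Φ p.1 p.2)
    {V : Set E} (hV : IsOpen V) (r : ENNReal) :
    IsOpen {q | r < cantorMeasure (Φ q ⁻¹' V)} := by
  rw [isOpen_iff_mem_nhds]
  intro q hq
  have hqV : IsOpen (Φ q ⁻¹' V) := hV.preimage (hΦ.comp (.prodMk_right q))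
  obtain ⟨K, hKV, hK, hr⟩ := hqV.exists_lt_isCompact hq
  obtain ⟨u, v, hu, -, hqu, hKv, huv⟩ := generalized_tube_lemma (isCompact_singleton (x := q)) hK
    (hV.preimage hΦ) (by rintro ⟨a, b⟩ ⟨rfl, hb⟩; exact hKV hb)
  filter_upwards [hu.mem_nhds (hqu rfl)] with q' hq'
  exact hr.trans_le (measure_mono fun ω hω => huv (mk_mem_prod hq' (hKv hω)))

/-- A form of Dini's theorem: an increasing open exhaustion of a set that is almost sure for all
parameters in a compact space exhausts it uniformly. -/
theorem exists_forall_measure_preimage_compl_le [CompactSpace Q]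
    (hΦ : Continuous fun p : Q × CantorSpace => Φ p.1 p.2)
    {V : ℕ → Set E} (hV : ∀ n, IsOpen (V n)) (hmono : Monotone V)
    (hfull : ∀ q, cantorMeasure (Φ q ⁻¹' ⋃ n, V n) = 1) {ε : ENNReal} (hε : ε ≠ 0) :
    ∃ k, ∀ q, cantorMeasure (Φ q ⁻¹' (V k)ᶜ) ≤ ε := by
  have hcover : (univ : Set Q) ⊆ ⋃ k, {q | 1 - ε < cantorMeasure (Φ q ⁻¹' V k)} := by
    intro q _
    have h1 : Tendsto (fun k => cantorMeasure (Φ q ⁻¹' V k)) atTop (𝓝 1) := by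
      rw [← hfull q, preimage_iUnion]
      exact tendsto_measure_iUnion_atTop fun m n h => preimage_mono (hmono h)
    obtain ⟨k, hk⟩ := (h1.eventually_const_lt
      (ENNReal.sub_lt_self ENNReal.one_ne_top one_ne_zero hε)).exists
    exact mem_iUnion.2 ⟨k, hk⟩
  obtain ⟨k, hk⟩ := isCompact_univ.elim_directed_cover _
    (fun k => isOpen_setOf_lt_measure_preimage hΦ (hV k) _) hcover
    (Monotone.directed_le fun m n h q hq =>
      lt_of_lt_of_le hq (measure_mono (preimage_mono (hmono h))))
  refine ⟨k, fun q => ?_⟩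
  have h2 : 1 - ε < cantorMeasure (Φ q ⁻¹' V k) := hk (mem_univ q)
  have hm : MeasurableSet (Φ q ⁻¹' V k) :=
    ((hV k).preimage (hΦ.comp (.prodMk_right q))).measurableSet
  rw [preimage_compl, prob_compl_eq_one_sub hm, tsub_le_iff_right]
  exact (tsub_le_iff_left.1 h2.le)

end Uniform

/-! ### Generic sets are Hurewicz and λ'. -/

section Generic

variable {Q E : Type} [TopologicalSpace Q] [TopologicalSpace E]
  [MeasurableSpace E] [BorelSpace E] {Φ : Q → CantorSpace → E} {X : Set E}

theorem IsGenericSet.measure_preimage_eq_one (hX : IsGenericSet Φ X)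
    (hΦ : Continuous fun p : Q × CantorSpace => Φ p.1 p.2) {U : Set E} (hU : IsOpen U)
    (hXU : X ⊆ U) (q : Q) : cantorMeasure (Φ q ⁻¹' U) = 1 := by
  have hm : MeasurableSet (Φ q ⁻¹' U) := (hU.preimage (hΦ.comp (.prodMk_right q))).measurableSet
  by_contra h
  obtain ⟨ω, hω, hωU⟩ := hX.meets q Uᶜ hU.measurableSet.compl (by
    rw [preimage_compl]
    exact fun h0 => h ((prob_compl_eq_zero_iff hm).1 h0))
  exact hωU (hXU hω)

theorem IsGenericSet.isHurewicz [CompactSpace Q] [SecondCountableTopology E] (hX : IsGenericSet Φ X)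
    (hb : boundingNumber = Cardinal.continuum)
    (hΦ : Continuous fun p : Q × CantorSpace => Φ p.1 p.2) : IsHurewicz X := by
  classical
  intro 𝒰 h𝒰
  rcases X.eq_empty_or_nonempty with rfl | ⟨x₀, hx₀⟩
  · exact ⟨fun _ => ∅, fun n => ⟨empty_subset _, finite_empty⟩, by simp⟩
  have hcount : ∀ n, ∃ u : ℕ → Set E, (∀ k, u k ∈ 𝒰 n) ∧ X ⊆ ⋃ k, u k := by
    intro n
    obtain ⟨T, hTc, hTU, hT⟩ := TopologicalSpace.isOpen_sUnion_countable (𝒰 n) (h𝒰 n).1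
    have hTne : T.Nonempty := by
      have := (h𝒰 n).2 hx₀
      rw [← hT] at this
      obtain ⟨t, ht, -⟩ := this
      exact ⟨t, ht⟩
    obtain ⟨u, rfl⟩ := hTc.exists_eq_range hTne
    refine ⟨u, fun k => hTU ⟨k, rfl⟩, ?_⟩
    rw [← sUnion_range, hT]
    exact (h𝒰 n).2
  choose u hu𝒰 hXu using hcount
  have huo : ∀ n k, IsOpen (u n k) := fun n k => (h𝒰 n).1 _ (hu𝒰 n k)
  have hVo : ∀ n k, IsOpen (accumulate (u n) k) := fun n k =>
    isOpen_biUnion fun i _ => huo n i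
  have hk : ∀ n, ∃ k, ∀ q, cantorMeasure (Φ q ⁻¹' (accumulate (u n) k)ᶜ) ≤ 2⁻¹ ^ n := by
    intro n
    refine exists_forall_measure_preimage_compl_le hΦ (hVo n) monotone_accumulate (fun q => ?_)
      (by simp)
    rw [iUnion_accumulate]
    exact hX.measure_preimage_eq_one hΦ (isOpen_iUnion (huo n)) (hXu n) q
  choose k hk using hk
  -- Borel–Cantelli: the bounds 2⁻ⁿ hold for all parameters and are summable.
  have hsmall := hX.small (limsup (fun n => (accumulate (u n) (k n))ᶜ) atTop)
    (.measurableSet_limsup fun n => (hVo n _).measurableSet.compl) (fun q => by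
      have h := measure_limsup_atTop_eq_zero (μ := cantorMeasure)
        (s := fun n => Φ q ⁻¹' (accumulate (u n) (k n))ᶜ)
        (ne_top_of_le_ne_top (by rw [ENNReal.tsum_geometric]; simp)
          (ENNReal.tsum_le_tsum fun n => hk n q))
      refine measure_mono_null (fun ω hω => ?_) h
      rw [mem_preimage, mem_limsup_iff_frequently_mem] at hω
      rw [mem_limsup_iff_frequently_mem]
      exact hω)
  have hf : ∀ x : ↥(X ∩ limsup (fun n => (accumulate (u n) (k n))ᶜ) atTop), ∀ n,
      ∃ m, x.1 ∈ u n m := fun x n => mem_iUnion.1 (hXu n x.2.1)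
  choose f hf using hf
  obtain ⟨g, hg⟩ := exists_eventual_bound f (hb ▸ hsmall)
  refine ⟨fun n => u n '' Iic (max (k n) (g n)), fun n => ⟨?_, (finite_Iic _).image _⟩,
    fun x hx => ?_⟩
  · rintro _ ⟨i, -, rfl⟩
    exact hu𝒰 n i
  by_cases hxB : x ∈ limsup (fun n => (accumulate (u n) (k n))ᶜ) atTop
  · filter_upwards [hg ⟨x, hx, hxB⟩] with n hn
    exact ⟨_, ⟨_, hn.trans (le_max_right _ _), rfl⟩, hf ⟨x, hx, hxB⟩ n⟩
  · rw [mem_limsup_iff_frequently_mem, not_frequently] at hxB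
    filter_upwards [hxB] with n hn
    rw [notMem_compl_iff, mem_accumulate] at hn
    obtain ⟨i, hi, hxi⟩ := hn
    exact ⟨_, ⟨i, hi.trans (le_max_left _ _), rfl⟩, hxi⟩

/-- Each `d` gives a function bounding its distances to the points of `A`; one `g` dominates all of
these eventually. Taking radii from `max (g i) m` and letting `m` grow also deals with the finitely
many `i` where domination fails. -/
theorem exists_isGδ_superset_disjoint {E : Type} [MetricSpace E]
    {A D : Set E} (hA : A.Countable) (hD : Cardinal.mk D < boundingNumber) (hAD : Disjoint A D) :
    ∃ H, IsGδ H ∧ A ⊆ H ∧ Disjoint H D := by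
  rcases A.eq_empty_or_nonempty with rfl | hne
  · exact ⟨∅, .empty, subset_rfl, by simp⟩
  obtain ⟨a, rfl⟩ := hA.exists_eq_range hne
  have hf : ∀ d : D, ∀ i, ∃ n : ℕ, 1 / ((n : ℝ) + 1) < dist d.1 (a i) := fun d i =>
    exists_nat_one_div_lt (dist_pos.2 fun h => hAD.le_bot ⟨⟨i, h.symm⟩, d.2⟩)
  choose f hf using hf
  obtain ⟨g, hg⟩ := exists_eventual_bound f hD
  refine ⟨⋂ m : ℕ, ⋃ i, Metric.ball (a i) (1 / ((max (g i) m : ℕ) + 1)),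
    .iInter_of_isOpen fun m => isOpen_iUnion fun i => Metric.isOpen_ball, ?_, ?_⟩
  · rintro _ ⟨i, rfl⟩
    refine mem_iInter.2 fun m => mem_iUnion.2 ⟨i, Metric.mem_ball_self (by positivity)⟩
  · rw [Set.disjoint_left]
    intro d hd hdD
    obtain ⟨N, hN⟩ := eventually_atTop.1 (hg ⟨d, hdD⟩)
    obtain ⟨i, hi⟩ := mem_iUnion.1 (mem_iInter.1 hd
      ((Finset.range N).sup (f ⟨d, hdD⟩)))
    rw [Metric.mem_ball] at hi
    refine absurd ((hf ⟨d, hdD⟩ i).trans hi) (not_lt.2 ?_)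
    refine one_div_le_one_div_of_le (by positivity) ?_
    have : f ⟨d, hdD⟩ i ≤ max (g i) ((Finset.range N).sup (f ⟨d, hdD⟩)) := by
      rcases lt_or_ge i N with h | h
      · exact (Finset.le_sup (Finset.mem_range.2 h)).trans (le_max_right _ _)
      · exact (hN i h).trans (le_max_left _ _)
    gcongr

/-- Dini, applied to complements of shrinking balls, makes small balls around a point uniformly
small in probability; the countably many bounds are chosen summable. -/
theorem exists_isOpen_superset_measure_preimage_le [CompactSpace Q] {E : Type} [MetricSpace E]
    {Φ : Q → CantorSpace → E} (hΦ : Continuous fun p : Q × CantorSpace => Φ p.1 p.2)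
    (hatom : ∀ q e, cantorMeasure (Φ q ⁻¹' {e}) = 0) {A : Set E} (hA : A.Countable)
    {ε : ENNReal} (hε : ε ≠ 0) :
    ∃ O, IsOpen O ∧ A ⊆ O ∧ ∀ q, cantorMeasure (Φ q ⁻¹' O) ≤ ε := by
  have hpt : ∀ a : E, ∀ δ : ENNReal, δ ≠ 0 →
      ∃ O, IsOpen O ∧ a ∈ O ∧ ∀ q, cantorMeasure (Φ q ⁻¹' O) ≤ δ := by
    intro a δ hδ
    obtain ⟨k, hk⟩ := exists_forall_measure_preimage_compl_le hΦ
      (V := fun n : ℕ => (Metric.closedBall a (1 / ((n : ℝ) + 1)))ᶜ)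
      (fun n => Metric.isClosed_closedBall.isOpen_compl)
      (fun m n h => compl_subset_compl.2 (Metric.closedBall_subset_closedBall
        (one_div_le_one_div_of_le (by positivity) (by gcongr)))) (fun q => by
        have hU : (⋃ n : ℕ, (Metric.closedBall a (1 / ((n : ℝ) + 1)))ᶜ) = {a}ᶜ := by
          ext x
          simp only [mem_iUnion, mem_compl_iff, Metric.mem_closedBall, not_le, mem_singleton_iff]
          exact ⟨fun ⟨n, hn⟩ h => absurd hn (by simp [h]; positivity),
            fun h => exists_nat_one_div_lt (dist_pos.2 h)⟩
        have hm : MeasurableSet (Φ q ⁻¹' {a}) :=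
          (isClosed_singleton.preimage (hΦ.comp (.prodMk_right q))).measurableSet
        rw [hU, preimage_compl, prob_compl_eq_one_iff hm]
        exact hatom q a) hδ
    refine ⟨Metric.ball a (1 / ((k : ℝ) + 1)), Metric.isOpen_ball,
      Metric.mem_ball_self (by positivity), fun q => (measure_mono ?_).trans (hk q)⟩
    rw [compl_compl]
    exact preimage_mono Metric.ball_subset_closedBall
  rcases A.eq_empty_or_nonempty with rfl | hne
  · exact ⟨∅, isOpen_empty, subset_rfl, by simp⟩
  obtain ⟨a, rfl⟩ := hA.exists_eq_range hne
  obtain ⟨δ, hδ0, hδ⟩ := ENNReal.exists_pos_sum_of_countable' hε ℕ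
  choose O hO haO hOm using fun i => hpt (a i) (δ i) (hδ0 i).ne'
  refine ⟨⋃ i, O i, isOpen_iUnion hO, ?_, fun q => ?_⟩
  · rintro _ ⟨i, rfl⟩
    exact mem_iUnion.2 ⟨i, haO i⟩
  · rw [preimage_iUnion]
    exact (measure_iUnion_le _).trans ((ENNReal.tsum_le_tsum fun i => hOm i q).trans hδ.le)

theorem IsGenericSet.isLambdaPrime [CompactSpace Q] {E : Type} [MetricSpace E] [MeasurableSpace E] [BorelSpace E]
    {Φ : Q → CantorSpace → E} {X : Set E} (hX : IsGenericSet Φ X)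
    (hb : boundingNumber = Cardinal.continuum)
    (hΦ : Continuous fun p : Q × CantorSpace => Φ p.1 p.2)
    (hatom : ∀ q e, cantorMeasure (Φ q ⁻¹' {e}) = 0) : IsLambdaPrime X := by
  intro A hA
  choose O hO hAO hOm using fun n : ℕ => exists_isOpen_superset_measure_preimage_le hΦ hatom hA
    (ε := 2⁻¹ ^ n) (by simp)
  have hGδ : IsGδ (⋂ n, O n) := .iInter_of_isOpen hO
  have hsmall := hX.small (⋂ n, O n) hGδ.measurableSet fun q =>
    le_antisymm (ge_of_tendsto' 
      (ENNReal.tendsto_pow_atTop_nhds_zero_of_lt_one (by simp : (2⁻¹ : ENNReal) < 1)) fun n =>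
        (measure_mono (preimage_mono (iInter_subset _ n))).trans (hOm n q)) zero_le
  -- Fewer than 𝔟 points of `X` outside `A` survive in the null G_δ; a second G_δ removes them.
  obtain ⟨H, hH, hAH, hHD⟩ := exists_isGδ_superset_disjoint (D := (X ∩ ⋂ n, O n) \ A) hA
    (hb ▸ (Cardinal.mk_le_mk_of_subset sdiff_subset).trans_lt hsmall) disjoint_sdiff_right
  have hset : ((↑) ⁻¹' A : Set ↥(X ∪ A)) = (↑) ⁻¹' (H ∩ ⋂ n, O n) := by
    ext ⟨x, hx⟩
    simp only [mem_preimage]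
    refine ⟨fun h => ⟨hAH h, mem_iInter.2 fun n => hAO n h⟩, fun h => ?_⟩
    by_contra hxA
    exact hHD.le_bot ⟨h.1, ⟨hx.resolve_right hxA, h.2⟩, hxA⟩
  rw [hset]
  exact (hH.inter hGδ).preimage continuous_subtype_val

end Generic

/-! ### Total imperfectness and transfer along maps. -/

section Imperfect

theorem not_isGδ_of_countable_dense {A : Set CantorSpace} (hA : A.Countable) (hd : Dense A) :
    ¬ IsGδ A := by
  intro hG
  have hne : ∀ x : CantorSpace, (𝓝[≠] x).NeBot := by
    intro x
    rw [← mem_closure_iff_nhdsWithin_neBot]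
    have ht : Tendsto (fun n : ℕ => Function.update x n (!x n)) atTop (𝓝 x) := by
      refine tendsto_pi_nhds.2 fun i => tendsto_const_nhds.congr' ?_
      filter_upwards [eventually_gt_atTop i] with n hn
      rw [Function.update_of_ne hn.ne]
    refine mem_closure_of_tendsto ht (Eventually.of_forall fun n h => ?_)
    have := congrFun (mem_singleton_iff.1 h) n
    simp at this
  have h1 : Dense (⋂ a ∈ A, ({a}ᶜ : Set CantorSpace)) :=
    dense_biInter_of_isOpen (fun a _ => isOpen_compl_singleton) hA
      fun a _ => dense_compl_singleton a
  have h2 : Dense (A ∩ ⋂ a ∈ A, ({a}ᶜ : Set CantorSpace)) :=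
    hd.inter_of_Gδ hG (.biInter_of_isOpen hA fun a _ => isOpen_compl_singleton) h1
  obtain ⟨x, hxA, hx⟩ := h2.nonempty
  exact mem_iInter₂.1 hx x hxA rfl

/-- A countable dense subset of a perfect set in `X` would be a relative G_δ there, contradicting
Baire's theorem. -/
theorem IsLambdaPrime.isTotallyImperfect {E : Type*} [TopologicalSpace E] {X : Set E}
    (hX : IsLambdaPrime X) : IsTotallyImperfect X := by
  rintro ⟨P, hPX, ⟨φ⟩⟩
  obtain ⟨S, hSc, hSd⟩ := TopologicalSpace.exists_countable_dense CantorSpace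
  let ψ : CantorSpace → E := fun z => φ z
  have hinj : Function.Injective ψ := Subtype.val_injective.comp φ.injective
  have hψ : ∀ z, ψ z ∈ X ∪ ψ '' S := fun z => Or.inl (hPX (φ z).2)
  have hc : Continuous fun z => (⟨ψ z, hψ z⟩ : ↥(X ∪ ψ '' S)) :=
    (continuous_subtype_val.comp φ.continuous).subtype_mk _
  have h := (hX (ψ '' S) (hSc.image ψ)).preimage hc
  refine not_isGδ_of_countable_dense hSc hSd ?_
  rwa [show (fun z => (⟨ψ z, hψ z⟩ : ↥(X ∪ ψ '' S))) ⁻¹' ((↑) ⁻¹' (ψ '' S)) = S from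
    preimage_image_eq S hinj] at h

theorem IsTotallyImperfect.image_homeomorph {E E' : Type*} [TopologicalSpace E]
    [TopologicalSpace E'] {X : Set E} (hX : IsTotallyImperfect X) (j : E ≃ₜ E') :
    IsTotallyImperfect (j '' X) := by
  rintro ⟨P, hPX, ⟨φ⟩⟩
  refine hX ⟨j.symm '' P, ?_, ⟨φ.trans (j.symm.image P)⟩⟩
  rintro _ ⟨y, hy, rfl⟩
  obtain ⟨x, hx, rfl⟩ := hPX hy
  simpa using hx

theorem IsHurewicz.image {E E' : Type*} [TopologicalSpace E] [TopologicalSpace E'] {X : Set E}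
    (hX : IsHurewicz X) {f : E → E'} (hf : Continuous f) : IsHurewicz (f '' X) := by
  intro 𝒰 h𝒰
  have hcover : ∀ n, (∀ V ∈ preimage f '' 𝒰 n, IsOpen V) ∧ X ⊆ ⋃₀ (preimage f '' 𝒰 n) := by
    refine fun n => ⟨?_, fun x hx => ?_⟩
    · rintro _ ⟨U, hU, rfl⟩
      exact ((h𝒰 n).1 U hU).preimage hf
    · obtain ⟨U, hU, hxU⟩ := (h𝒰 n).2 (mem_image_of_mem f hx)
      exact ⟨_, ⟨U, hU, rfl⟩, hxU⟩
  obtain ⟨ℱ, hℱ, hXℱ⟩ := hX _ hcover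
  have h𝒱 : ∀ n, ∃ 𝒱 ⊆ 𝒰 n, 𝒱.Finite ∧ ℱ n = preimage f '' 𝒱 := fun n =>
    exists_subset_image_finite_and.1 ⟨ℱ n, (hℱ n).1, (hℱ n).2, rfl⟩
  choose 𝒱 h𝒱 using h𝒱
  refine ⟨𝒱, fun n => ⟨(h𝒱 n).1, (h𝒱 n).2.1⟩, ?_⟩
  rintro _ ⟨x, hx, rfl⟩
  filter_upwards [hXℱ x hx] with n hn
  rw [(h𝒱 n).2.2] at hn
  obtain ⟨_, ⟨U, hU, rfl⟩, hxU⟩ := hn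
  exact ⟨U, hU, hxU⟩

end Imperfect

/-! ### Binary trees of blocks: Baire category and pigeonhole. -/

section Trees

/-- The product of the finite spaces of blocks of lengths `2, 3, 4, …`. -/
abbrev BlockSpace : Type := ∀ k : ℕ, Fin (k + 2) → Bool

/-- The branch through a family of labels `T` that is determined by a sequence of bits. -/
def branch (T : ∀ k : ℕ, (Fin (k + 1) → Bool) → Fin (k + 2) → Bool) (ω : CantorSpace) :
    BlockSpace :=
  fun k => T k fun i => ω i

/-- Nodes of the binary tree that first differ in their last bit have different labels. -/
def IsSplitting (T : ∀ k : ℕ, (Fin (k + 1) → Bool) → Fin (k + 2) → Bool) : Prop :=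
  ∀ (k : ℕ) (ω ω' : CantorSpace), (∀ i < k, ω i = ω' i) → ω k ≠ ω' k →
    branch T ω k ≠ branch T ω' k

/-- The space of labelings that describe binary subtrees of the tree of finite sequences of
blocks. -/
abbrev SplittingTree : Type :=
  {T : ∀ k : ℕ, (Fin (k + 1) → Bool) → Fin (k + 2) → Bool // IsSplitting T}

theorem isClosed_setOf_isSplitting : IsClosed {T | IsSplitting T} := by
  simp only [IsSplitting, ofPred_forall]
  refine isClosed_iInter fun k => isClosed_iInter fun ω => isClosed_iInter fun ω' =>
    isClosed_iInter fun _ => isClosed_iInter fun _ => ?_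
  have hc : Continuous fun T : ∀ k : ℕ, (Fin (k + 1) → Bool) → Fin (k + 2) → Bool =>
      (branch T ω k, branch T ω' k) := by
    unfold branch; fun_prop
  exact (isClosed_discrete {p : (Fin (k + 2) → Bool) × (Fin (k + 2) → Bool) | p.1 ≠ p.2}).preimage
    hc

instance : CompactSpace SplittingTree :=
  isCompact_iff_compactSpace.1 isClosed_setOf_isSplitting.isCompact

instance : Nonempty SplittingTree :=
  ⟨⟨fun k s _ => s (Fin.last k), fun k ω ω' _ hne h => hne (by simpa [branch] using congrFun h 0)⟩⟩

theorem branch_injective {T : ∀ k : ℕ, (Fin (k + 1) → Bool) → Fin (k + 2) → Bool}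
    (hT : IsSplitting T) : Function.Injective (branch T) := by
  classical
  intro ω ω' h
  by_contra hne
  have hex : ∃ n, ω n ≠ ω' n := Function.ne_iff.1 hne
  exact hT _ ω ω' (fun i hi => not_not.1 (Nat.find_min hex hi)) (Nat.find_spec hex)
    (congrFun h _)

theorem continuous_branch :
    Continuous fun p : SplittingTree × CantorSpace => branch p.1.1 p.2 := by
  refine continuous_pi fun k => ?_
  have h1 : Continuous fun p : ((Fin (k + 1) → Bool) → Fin (k + 2) → Bool) ×
      (Fin (k + 1) → Bool) => p.1 p.2 :=
    continuous_prod_of_discrete_right.2 fun s => continuous_apply s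
  exact h1.comp (g := fun p : ((Fin (k + 1) → Bool) → Fin (k + 2) → Bool) ×
      (Fin (k + 1) → Bool) => p.1 p.2)
    (f := fun p : SplittingTree × CantorSpace => (p.1.1 k, fun i : Fin (k + 1) => p.2 i))
    (((continuous_apply k).comp (continuous_subtype_val.comp continuous_fst)).prodMk
      (by fun_prop))

/-- The point that agrees with `w` below `k` and with `z` from `k` on. -/
def splice (k : ℕ) (w z : BlockSpace) : BlockSpace := fun j => if j < k then w j else z j

/-- Above the node `w` of length `k` there is a binary tree none of whose branches is in `F`. -/
def Escapes (F : Set BlockSpace) (k : ℕ) (w : BlockSpace) : Prop :=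
  ∃ T, IsSplitting T ∧ ∀ ω, splice k w (branch T ω) ∉ F

theorem Escapes.congr {F : Set BlockSpace} {k : ℕ} {w w' : BlockSpace} (h : Escapes F k w)
    (hw : ∀ j < k, w j = w' j) : Escapes F k w' := by
  obtain ⟨T, hT, hF⟩ := h
  refine ⟨T, hT, fun ω => ?_⟩
  rw [show splice k w' (branch T ω) = splice k w (branch T ω) from
    funext fun j => by unfold splice; split_ifs with hj; exacts [(hw j hj).symm, rfl]]
  exact hF ω

theorem exists_mem_of_not_escapes {F : Set BlockSpace} {k : ℕ} {w : BlockSpace}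
    (h : ¬ Escapes F k w) : ∃ z ∈ F, ∀ j < k, z j = w j := by
  obtain ⟨T, hT⟩ := (inferInstance : Nonempty SplittingTree)
  by_contra! hF
  refine h ⟨T, hT, fun ω hω => ?_⟩
  obtain ⟨j, hj, hne⟩ := hF _ hω
  exact hne (by simp [splice, hj])

/-- Join the two trees: bit `k` selects the label `a` or `b` and the tree followed afterwards.
Labels below `k` are overwritten by `splice` and only have to be splitting. -/
theorem escapes_of_update {F : Set BlockSpace} {k : ℕ} {w : BlockSpace}
    {a b : Fin (k + 2) → Bool} (hab : a ≠ b)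
    (ha : Escapes F (k + 1) (Function.update w k a))
    (hb : Escapes F (k + 1) (Function.update w k b)) : Escapes F k w := by
  obtain ⟨T₁, hT₁, hF₁⟩ := ha
  obtain ⟨T₂, hT₂, hF₂⟩ := hb
  let bit : ∀ j, (Fin (j + 1) → Bool) → Bool :=
    fun j s => if h : k < j + 1 then s ⟨k, h⟩ else false
  let T : ∀ j : ℕ, (Fin (j + 1) → Bool) → Fin (j + 2) → Bool := fun j s =>
    if j = k then Function.update w k (if bit j s then b else a) j
    else if bit j s then T₂ j s else T₁ j s
  have hlt : ∀ ω : CantorSpace, ∀ j < k, branch T ω j = branch T₁ ω j := by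
    intro ω j hj
    have h1 : ¬ k ≤ j := by omega
    simp [branch, T, bit, hj.ne, h1]
  have heq : ∀ ω : CantorSpace, branch T ω k = if ω k then b else a := by
    intro ω
    simp [branch, T, bit]
  have hgt : ∀ ω : CantorSpace, ∀ j, k < j →
      branch T ω j = if ω k then branch T₂ ω j else branch T₁ ω j := by
    intro ω j hj
    simp [branch, T, bit, hj.ne', hj.le]
  refine ⟨T, fun n ω ω' hlow hne => ?_, fun ω => ?_⟩
  · rcases lt_trichotomy n k with h | rfl | h
    · rw [hlt _ _ h, hlt _ _ h]
      exact hT₁ n ω ω' hlow hne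
    · rw [heq, heq]
      rcases h1 : ω n <;> rcases h2 : ω' n <;> simp_all [hab.symm]
    · rw [hgt _ _ h, hgt _ _ h, hlow k h]
      split_ifs
      · exact hT₂ n ω ω' hlow hne
      · exact hT₁ n ω ω' hlow hne
  · have hsp : splice k w (branch T ω) = splice (k + 1)
        (Function.update w k (if ω k then b else a))
        (if ω k then branch T₂ ω else branch T₁ ω) := by
      funext j
      unfold splice
      rcases lt_trichotomy j k with h | rfl | h
      · rw [if_pos h, if_pos (by omega), Function.update_of_ne h.ne]
      · rw [if_neg (lt_irrefl _), if_pos (by omega), Function.update_self, heq]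
      · rw [if_neg (by omega), if_neg (by omega), hgt _ _ h]
        split_ifs <;> rfl
    rw [hsp]
    split_ifs
    · exact hF₂ ω
    · exact hF₁ ω

/-- Adding the bit `ε k` to all entries of the `k`-th block. -/
def flipBlocks (ε : CantorSpace) (y : BlockSpace) : BlockSpace := fun k i => xor (y k i) (ε k)

theorem flipBlocks_apply (ε : CantorSpace) (y : BlockSpace) (k : ℕ) :
    flipBlocks ε y k = fun i => xor (y k i) (ε k) := rfl

/-- If every label `a` failed through some flip `ε a`, two labels would share the flip bits up to
`k`; their flipped labels still differ, so the two escaping trees join below. -/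
theorem exists_update_not_escapes {F : Set BlockSpace} {k₀ k : ℕ} {y : BlockSpace}
    (h : ∀ ε : CantorSpace, (∀ j < k₀, ε j = false) → ¬ Escapes F k (flipBlocks ε y)) :
    ∃ a, ∀ ε : CantorSpace, (∀ j < k₀, ε j = false) →
      ¬ Escapes F (k + 1) (flipBlocks ε (Function.update y k a)) := by
  by_contra! hbad
  choose ε hε hesc using hbad
  have hflip : ∀ (δ : CantorSpace) (a : Fin (k + 2) → Bool),
      flipBlocks δ (Function.update y k a) =
        Function.update (flipBlocks δ y) k fun i => xor (a i) (δ k) := by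
    intro δ a
    funext j
    rcases eq_or_ne j k with rfl | hj
    · simp [flipBlocks_apply]
    · simp [flipBlocks_apply, hj]
  have hinj : Function.Injective fun (a : Fin (k + 2) → Bool) (i : Fin (k + 1)) => ε a i := by
    intro a a' haa'
    by_contra hne
    have hk : ∀ j < k + 1, ε a j = ε a' j := fun j hj => congrFun haa' ⟨j, hj⟩
    have h1 := hesc a
    have h2 : Escapes F (k + 1) (flipBlocks (ε a) (Function.update y k a')) :=
      (hesc a').congr fun j hj => by simp [flipBlocks_apply, hk j hj]
    rw [hflip] at h1 h2
    refine h _ (hε a) (escapes_of_update (fun h3 => hne (funext fun i => ?_)) h1 h2)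
    simpa using congrFun h3 i
  have hcard := Fintype.card_le_of_injective _ hinj
  simp only [Fintype.card_fun, Fintype.card_bool, Fintype.card_fin] at hcard
  exact absurd hcard (not_le.2 (Nat.pow_lt_pow_right one_lt_two (by omega)))

/-- Choose blocks one at a time, keeping every flip non-escaping. A non-escaping node has a point of
`F` through it, so closedness puts each flip of the limit in `F`. -/
theorem exists_forall_flipBlocks_mem {F : Set BlockSpace} (hF : IsClosed F) {k₀ : ℕ}
    {w : BlockSpace} (h : ¬ Escapes F k₀ w) :
    ∃ y, ∀ ε : CantorSpace, (∀ j < k₀, ε j = false) → flipBlocks ε y ∈ F := by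
  let R : ℕ → BlockSpace → Prop := fun k y =>
    ∀ ε : CantorSpace, (∀ j < k₀, ε j = false) → ¬ Escapes F k (flipBlocks ε y)
  have hstep : ∀ (n : ℕ) (y : BlockSpace), ∃ y' : BlockSpace, (∀ j < k₀ + n, y' j = y j) ∧
      (R (k₀ + n) y → R (k₀ + n + 1) y') := by
    intro n y
    by_cases hy : R (k₀ + n) y
    · obtain ⟨a, ha⟩ := exists_update_not_escapes hy
      exact ⟨_, fun j hj => Function.update_of_ne hj.ne _ _, fun _ => ha⟩
    · exact ⟨y, fun _ _ => rfl, fun h => absurd h hy⟩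
  choose next hnext hR using hstep
  let Y : ℕ → BlockSpace := fun n => Nat.rec w next n
  have hY : ∀ n, R (k₀ + n) (Y n) := by
    intro n
    induction n with
    | zero =>
      intro ε hε hesc
      refine h (hesc.congr fun j hj => ?_)
      simp [flipBlocks_apply, hε j hj, Y]
    | succ n ih => exact hR n _ ih
  have hstable : ∀ n m, n ≤ m → ∀ j < k₀ + n, Y m j = Y n j := by
    intro n m hnm
    induction m, hnm using Nat.le_induction with
    | base => exact fun _ _ => rfl
    | succ m hm ih => exact fun j hj => (hnext m (Y m) j (by omega)).trans (ih j hj)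
  refine ⟨fun j => Y (j + 1) j, fun ε hε => ?_⟩
  choose z hzF hz using fun n => exists_mem_of_not_escapes (hY n ε hε)
  refine hF.mem_of_tendsto (f := z) (b := atTop) (tendsto_pi_nhds.2 fun j => ?_)
    (Eventually.of_forall hzF)
  refine tendsto_const_nhds.congr' ?_
  filter_upwards [eventually_gt_atTop j] with n hn
  rw [hz n j (by omega)]
  simp only [flipBlocks_apply]
  rw [hstable (j + 1) n hn j (by omega)]

/-- Baire category in the compact space of trees: missing `F n` is an open condition by compactness
of the bits, and dense because escaping trees can be grafted at any height. -/
theorem exists_isSplitting_forall_notMem {F : ℕ → Set BlockSpace} (hF : ∀ n, IsClosed (F n))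
    (h : ∀ n k w, Escapes (F n) k w) :
    ∃ T, IsSplitting T ∧ ∀ n ω, branch T ω ∉ F n := by
  let O : ℕ → Set SplittingTree := fun n => {T | ∀ ω, branch T.1 ω ∉ F n}
  have hO : ∀ n, IsOpen (O n) := by
    intro n
    have hc : IsClosed (Prod.fst '' {p : SplittingTree × CantorSpace | branch p.1.1 p.2 ∈ F n}) :=
      isClosedMap_fst_of_compactSpace _ ((hF n).preimage continuous_branch)
    convert hc.isOpen_compl using 1
    ext T
    simp [O]
  have hd : ∀ n, Dense (O n) := by
    intro n T₀
    choose S hS hSF using h n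
    let ext0 : ∀ k j : ℕ, (Fin (j + 1) → Bool) → CantorSpace := fun k j s i =>
      if hi : i < k ∧ i < j + 1 then s ⟨i, hi.2⟩ else false
    -- Follow `T₀` below height `k`, then the escaping tree above the node reached; these converge
    -- to `T₀`.
    let U : ∀ k j : ℕ, (Fin (j + 1) → Bool) → Fin (j + 2) → Bool := fun k j s =>
      if j < k then T₀.1 j s else S k (branch T₀.1 (ext0 k j s)) j s
    have hlt : ∀ k (ω : CantorSpace), ∀ j < k, branch (U k) ω j = branch T₀.1 ω j := by
      intro k ω j hj
      simp [branch, U, hj]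
    have hge : ∀ k (ω : CantorSpace), ∀ j, k ≤ j → branch (U k) ω j =
        branch (S k (branch T₀.1 fun i => if i < k then ω i else false)) ω j := by
      intro k ω j hj
      have h1 : ext0 k j (fun i => ω i) = fun i => if i < k then ω i else false := by
        funext i
        by_cases hi : i < k
        · simp [ext0, hi, show i ≤ j by omega]
        · simp [ext0, hi]
      rw [← h1]
      simp [branch, U, not_lt.2 hj]
    have hU : ∀ k, IsSplitting (U k) := by
      intro k m ω ω' hlow hne
      rcases lt_or_ge m k with hm | hm
      · rw [hlt _ _ _ hm, hlt _ _ _ hm]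
        exact T₀.2 m ω ω' hlow hne
      · rw [hge _ _ _ hm, hge _ _ _ hm]
        rw [show (fun i => if i < k then ω i else false) =
          fun i => if i < k then ω' i else false from funext fun i => by
            split_ifs with hi
            exacts [hlow i (by omega), rfl]]
        exact hS _ _ m ω ω' hlow hne
    have hUO : ∀ k, (⟨U k, hU k⟩ : SplittingTree) ∈ O n := by
      intro k ω
      have hsp : branch (U k) ω = splice k (branch T₀.1 fun i => if i < k then ω i else false)
          (branch (S k (branch T₀.1 fun i => if i < k then ω i else false)) ω) := by
        funext j
        unfold splice
        split_ifs with hj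
        · rw [hlt _ _ _ hj]
          have h1 : (fun i : Fin (j + 1) => ω i) = fun i : Fin (j + 1) =>
              if (i : ℕ) < k then ω i else false :=
            funext fun i => (if_pos (by omega)).symm
          exact congrArg (T₀.1 j) h1
        · exact hge _ _ _ (not_lt.1 hj)
      rw [hsp]
      exact hSF _ _ ω
    refine mem_closure_of_tendsto (f := fun k => (⟨U k, hU k⟩ : SplittingTree)) (b := atTop) ?_
      (Eventually.of_forall hUO)
    refine tendsto_subtype_rng.2 (tendsto_pi_nhds.2 fun j => ?_)
    refine tendsto_const_nhds.congr' ?_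
    filter_upwards [eventually_gt_atTop j] with k hk
    funext s
    simp [U, hk]
  obtain ⟨T, hT⟩ := (dense_iInter_of_isOpen hO hd).nonempty
  exact ⟨T.1, T.2, fun n => mem_iInter.1 hT n⟩

theorem mk_splittingTree_le : Cardinal.mk SplittingTree ≤ Cardinal.continuum := by
  refine (Cardinal.mk_subtype_le _).trans ?_
  rw [Cardinal.mk_pi]
  refine (Cardinal.prod_le_prod _ (fun _ => Cardinal.aleph0) fun k => ?_).trans ?_
  · exact (Cardinal.lt_aleph0_of_finite _).le
  · simp

end Trees

/-! ### Coding blocks and pairs in the Cantor space. -/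

section Coordinates

theorem cantorMeasure_singleton (ω : CantorSpace) : cantorMeasure {ω} = 0 := by
  have key : ∀ n : ℕ, cantorMeasure {ω} ≤ (2⁻¹ : ENNReal) ^ n := by
    intro n
    have h := Measure.infinitePi_pi (fun _ : ℕ => (PMF.uniformOfFintype Bool).toMeasure)
      (s := Finset.range n) (t := fun i => {ω i}) (fun _ _ => measurableSet_singleton _)
    simp only [PMF.toMeasure_apply_singleton _ _ (measurableSet_singleton _),
      PMF.uniformOfFintype_apply, Fintype.card_bool, Finset.prod_const, Finset.card_range,
      Nat.cast_ofNat] at h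
    rw [← h]
    refine measure_mono ?_
    rintro _ rfl i _
    rfl
  exact le_antisymm (ge_of_tendsto'
    (ENNReal.tendsto_pow_atTop_nhds_zero_of_lt_one (by simp)) key) zero_le

/-- An enumeration of the positions in the blocks. -/
noncomputable def blockPosition : ℕ ≃ Σ k : ℕ, Fin (k + 2) :=
  Classical.choice nonempty_equiv_of_countable

/-- Concatenation of blocks in the order of the enumeration of positions. -/
noncomputable def blockHomeomorph : BlockSpace ≃ₜ CantorSpace where
  toFun z n := z (blockPosition n).1 (blockPosition n).2
  invFun c k i := c (blockPosition.symm ⟨k, i⟩)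
  left_inv z := funext fun k => funext fun i =>
    congrArg (fun p : Σ k : ℕ, Fin (k + 2) => z p.1 p.2) (blockPosition.apply_symm_apply ⟨k, i⟩)
  right_inv c := by simp
  continuous_toFun := by fun_prop
  continuous_invFun := by fun_prop

/-- Interleaving two points of the Cantor space. -/
def interleave : CantorSpace × CantorSpace ≃ₜ CantorSpace where
  toFun p n := Sum.elim p.1 p.2 (Equiv.natSumNatEquivNat.symm n)
  invFun c := (fun n => c (Equiv.natSumNatEquivNat (.inl n)),
    fun n => c (Equiv.natSumNatEquivNat (.inr n)))
  left_inv p := by simp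
  right_inv c := by
    funext n
    obtain ⟨s, rfl⟩ := Equiv.natSumNatEquivNat.surjective n
    rcases s with m | m <;> simp
  continuous_toFun := by
    refine continuous_pi fun n => ?_
    rcases Equiv.natSumNatEquivNat.symm n with m | m
    · exact (continuous_apply m).comp continuous_fst
    · exact (continuous_apply m).comp continuous_snd
  continuous_invFun := by fun_prop

/-- The point of the Cantor space that codes `y` in the fibre over the zero sequence. -/
noncomputable def zeroFibre (y : BlockSpace) : CantorSpace :=
  interleave (fun _ => false, blockHomeomorph y)

theorem continuous_zeroFibre : Continuous zeroFibre :=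
  interleave.continuous.comp (Continuous.prodMk_right _ |>.comp blockHomeomorph.continuous)

theorem zeroFibre_injective : Function.Injective zeroFibre := fun _ _ h =>
  blockHomeomorph.injective (Prod.ext_iff.1 (interleave.injective h)).2

/-- Identifies translates of the blockwise constant perfect set with families of flips. -/
theorem cantorAdd_zeroFibre (y : BlockSpace) (ε : CantorSpace) :
    cantorAdd (zeroFibre y) (zeroFibre fun k _ => ε k) = zeroFibre (flipBlocks ε y) := by
  funext n
  obtain ⟨s, rfl⟩ := Equiv.natSumNatEquivNat.surjective n
  rcases s with m | m <;>
    simp [cantorAdd, zeroFibre, interleave, blockHomeomorph, flipBlocks]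

end Coordinates

/-! ### Random branches in fibres, failure of PMT, and the conclusion. -/

/-- The random point of the vertical section over the first parameter along the binary tree given
by the second parameter. -/
noncomputable def treePoint (q : CantorSpace × SplittingTree) (ω : CantorSpace) :
    CantorSpace × CantorSpace :=
  (q.1, blockHomeomorph (branch q.2.1 ω))

theorem continuous_treePoint :
    Continuous fun p : (CantorSpace × SplittingTree) × CantorSpace => treePoint p.1 p.2 := by
  have h : Continuous fun p : (CantorSpace × SplittingTree) × CantorSpace =>
      branch p.1.2.1 p.2 :=
    continuous_branch.comp (g := fun p : SplittingTree × CantorSpace => branch p.1.1 p.2)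
      (f := fun p : (CantorSpace × SplittingTree) × CantorSpace => (p.1.2, p.2)) (by fun_prop)
  exact (continuous_fst.comp continuous_fst).prodMk (blockHomeomorph.continuous.comp h)

theorem measure_treePoint_preimage_singleton (q : CantorSpace × SplittingTree)
    (e : CantorSpace × CantorSpace) : cantorMeasure (treePoint q ⁻¹' {e}) = 0 := by
  have hsub : (treePoint q ⁻¹' {e}).Subsingleton := fun ω hω ω' hω' =>
    branch_injective q.2.2 (blockHomeomorph.injective
      (Prod.ext_iff.1 ((mem_singleton_iff.1 hω).trans (mem_singleton_iff.1 hω').symm)).2)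
  rcases hsub.eq_empty_or_singleton with h | ⟨ω, h⟩
  · simp [h]
  · rw [h, cantorMeasure_singleton]

theorem IsGenericSet.not_isPMT {X : Set (CantorSpace × CantorSpace)}
    (hX : IsGenericSet treePoint X) : ¬ IsPMT (interleave '' X) := by
  intro hpmt
  have hcP : Continuous fun ε : CantorSpace => zeroFibre fun k _ => ε k :=
    continuous_zeroFibre.comp (by fun_prop)
  have hiP : Function.Injective fun ε : CantorSpace => zeroFibre fun k _ => ε k := fun ε ε' h =>
    funext fun k => congrFun (congrFun (zeroFibre_injective h) k) 0
  obtain ⟨F, ⟨K, hK, rfl⟩, hXF, hmeagre⟩ := hpmt (range fun ε : CantorSpace => zeroFibre fun k _ => ε k)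
    ⟨(hcP.isClosedEmbedding hiP).isEmbedding.toHomeomorph⟩
  have hKc : ∀ n, IsClosed (zeroFibre ⁻¹' K n) := fun n =>
    (hK n).isClosed.preimage continuous_zeroFibre
  have hne : ∃ n k w, ¬ Escapes (zeroFibre ⁻¹' K n) k w := by
    by_contra! hesc
    obtain ⟨T, hT, hTF⟩ := exists_isSplitting_forall_notMem hKc hesc
    obtain ⟨ω, hω, -⟩ := hX.meets (fun _ => false, ⟨T, hT⟩) univ .univ (by simp)
    obtain ⟨n, hn⟩ := mem_iUnion.1 (hXF (mem_image_of_mem interleave hω))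
    exact hTF n ω hn
  obtain ⟨n, k₀, w, hw⟩ := hne
  obtain ⟨y, hy⟩ := exists_forall_flipBlocks_mem (hKc n) hw
  set t := zeroFibre y
  set P := cantorTranslate t (range fun ε : CantorSpace => zeroFibre fun k _ => ε k) with hP
  have hPeq : P = range fun ε => zeroFibre (flipBlocks ε y) := by
    rw [hP, cantorTranslate, ← range_comp]
    exact congrArg range (funext fun ε => cantorAdd_zeroFibre y ε)
  have hcflip : Continuous fun ε : CantorSpace => zeroFibre (flipBlocks ε y) := by
    refine continuous_zeroFibre.comp (continuous_pi fun k => continuous_pi fun i => ?_)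
    exact (continuous_of_discreteTopology (f := fun b => xor (y k i) b)).comp (continuous_apply k)
  have hcomp : IsCompact P := hPeq ▸ isCompact_range hcflip
  have : CompactSpace P := isCompact_iff_compactSpace.1 hcomp
  have h0 : t ∈ P := by
    rw [hPeq]
    exact ⟨fun _ => false, congrArg zeroFibre (by funext k i; simp [flipBlocks])⟩
  -- The open piece of the translate where the flip bits vanish below `k₀`; it lies inside `K n`.
  let O : Set P := {z | ∀ k < k₀,
    (blockHomeomorph.symm (interleave.symm z.1).2) k = y k}
  have hO : IsOpen O := by
    have hO' : O = ⋂ k ∈ Finset.range k₀,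
        {z : P | (blockHomeomorph.symm (interleave.symm z.1).2) k = y k} := by
      ext z
      simp [O]
    rw [hO']
    refine isOpen_biInter_finset fun k _ => ?_
    have hc : Continuous fun z : P => (blockHomeomorph.symm (interleave.symm z.1).2) k :=
      (continuous_apply k).comp (blockHomeomorph.symm.continuous.comp
        (continuous_snd.comp (interleave.symm.continuous.comp continuous_subtype_val)))
    exact (isOpen_discrete {y k}).preimage hc
  refine not_isMeagre_of_isOpen hO ⟨⟨t, h0⟩, fun k _ => by simp [t, zeroFibre]⟩
    ((hmeagre t).mono ?_)
  rintro ⟨z, hz⟩ hzO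
  obtain ⟨ε, rfl⟩ : z ∈ range fun ε => zeroFibre (flipBlocks ε y) := hPeq ▸ hz
  refine mem_iUnion.2 ⟨n, hy ε fun j hj => ?_⟩
  have h1 := congrFun (hzO j hj) 0
  simp only [zeroFibre, Homeomorph.symm_apply_apply, flipBlocks] at h1
  exact Bool.xor_right_inj.1 (h1.trans (Bool.xor_false _).symm)

theorem theorem2p1
    (h_cov_b : covNull = boundingNumber)
    (h_b_c : boundingNumber = Cardinal.continuum) :
    ∃ X : Set (CantorSpace × CantorSpace),
      IsHurewicz X ∧
      IsLambdaPrime X ∧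
      IsTotallyImperfect X ∧
      Prod.fst '' X = univ ∧
      ∃ Y : Set CantorSpace, Nonempty (X ≃ₜ Y) ∧
        IsHurewicz Y ∧ IsTotallyImperfect Y ∧ ¬ IsPMT Y := by
  let _ : MetricSpace (CantorSpace × CantorSpace) :=
    TopologicalSpace.metrizableSpaceMetric (CantorSpace × CantorSpace)
  obtain ⟨X, hX⟩ := exists_isGenericSet (Φ := treePoint) (h_cov_b.trans h_b_c) (by
      rw [Cardinal.mk_prod, Cardinal.lift_id, Cardinal.lift_id]
      exact (mul_le_mul' (by simp) mk_splittingTree_le).trans_eq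
        (Cardinal.mul_eq_self Cardinal.aleph0_le_continuum))
    fun q => (continuous_treePoint.comp (.prodMk_right q)).measurable
  have hH := hX.isHurewicz h_b_c continuous_treePoint
  have hL := hX.isLambdaPrime h_b_c continuous_treePoint measure_treePoint_preimage_singleton
  refine ⟨X, hH, hL, hL.isTotallyImperfect, eq_univ_of_forall fun x => ?_, interleave '' X,
    ⟨interleave.image X⟩, hH.image interleave.continuous,
    hL.isTotallyImperfect.image_homeomorph interleave, hX.not_isPMT⟩
  obtain ⟨T⟩ := (inferInstance : Nonempty SplittingTree)
  obtain ⟨ω, hω, -⟩ := hX.meets (x, T) univ .univ (by simp)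
  exact ⟨_, hω, rfl⟩
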